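/- Let $A_0[\|\cdot\|_0]$ be a unital $C^*$-normed algebra, i.e. a complex unital $*$-algebra with a (not necessarily complete) submultiplicative norm satisfying $\|x^*x\|_0=\|x\|_0^2$, and let $\widetilde{A_0}[\|\cdot\|_0]$ be its $C^*$-algebra completion. Let $\tau$ be a Hausdorff locally convex topology on $A_0$ defined by a directed family of seminorms $(p_\lambda)_{\lambda\in\Lambda}$, and let $\widetilde{A_0}[\tau]$ be the completion of $A_0[\tau]$. For a unital algebra $B$ with involution write $B_+=\{x\in B: x^*=x,\ \mathrm{sp}_B(x)\subseteq[0,\infty)\}$. Suppose that * $(T_1)$ the involution of $A_0$ is $\tau$-continuous and the multiplication is separately $\tau$-continuous; * $(T_2)$ $\tau$ is coarser than the norm topology, and every $\|\cdot\|_0$-Cauchy net in $A_0$ that $\tau$-converges to $0$ also converges to $0$ in norm (so that $A_0\subseteq\widetilde{A_0}[\|\cdot\|_0]\subseteq\widetilde{A_0}[\tau]$); * $(T_3)$ for every $\lambda$ there are $\lambda'$ and $\gamma_\lambda>0$ such that $p_\lambda(xy)\le\gamma_\lambda\|x\|_0\,p_{\lambda'}(y)$ for all $x,y\in A_0$ with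 $xy=yx$; * $(T_4)$ the set $\{x\in\widetilde{A_0}[\|\cdot\|_0]_+ : \|x\|_0\le 1\}$ is closed in $\widetilde{A_0}[\tau]$; * $(T_5)$ $\overline{(A_0)_+}^{\,\tau}\cap\widetilde{A_0}[\|\cdot\|_0]=\widetilde{A_0}[\|\cdot\|_0]_+$, the closure being taken in $\widetilde{A_0}[\tau]$. The involution of $A_0$ and the left and right multiplications by elements of $A_0$ extend by continuity to $\widetilde{A_0}[\tau]$. Let $A[\tau]$ be a locally convex quasi $C^*$-normed algebra over $A_0$, i.e. a linear subspace $A$ of $\widetilde{A_0}[\tau]$ that contains $\widetilde{A_0}[\|\cdot\|_0]$ and satisfies $a^*, ax, xa\in A$ for all $a\in A$, $x\in A_0$, with the topology induced by $\widetilde{A_0}[\tau]$. Then the following statements are equivalent. (i) There are a Hilbert space $H$, a dense subspace $D\subseteq H$ and a faithful (i.e. injective) $(\tau,\tau_{s^*})$-continuous $*$-representation $\pi$ of $A$ into $L^\dagger(D,H)$. (ii) The set $\mathcal S(A_0)$ of all $\tau$-continuous positive invariant sesquilinear forms on $A_0\times A_0$ is sufficient: if $a\in A$ and $\tilde\varphi(a,a)=0$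 for all $\varphi\in\mathcal S(A_0)$, then $a=0$, where $\tilde\varphi$ is the extension of $\varphi$ by $\tau$-continuity to $A\times A$. Here $L^\dagger(D,H)$ is the space of all linear operators $X:D\to H$ with $D\subseteq D(X^*)$; $X^\dagger=X^*|_D$; $X\,\Box\,Y=(X^\dagger)^*Y$ is defined when $YD\subseteq D((X^\dagger)^*)$ and $X^*D\subseteq D(Y^*)$; and $\tau_{s^*}$ is the topology given by the seminorms $X\mapsto\|X\xi\|+\|X^\dagger\xi\|$, $\xi\in D$. A $*$-representation of $A$ is a linear map $\pi:A\to L^\dagger(D,H)$ such that $\pi|_{A_0}$ is a $*$-representation of the $*$-algebra $A_0$ on $D$ (so $\pi(x)D\subseteq D$ and $\pi(xy)=\pi(x)\pi(y)$ for $x,y\in A_0$), $\pi(a)^\dagger=\pi(a^*)$ for $a\in A$, and, for all $a\in A$ and $x\in A_0$, the products $\pi(a)\,\Box\,\pi(x)$ and $\pi(x)\,\Box\,\pi(a)$ are defined and equal to $\pi(ax)$ and $\pi(xa)$. A sesquilinear form $\varphi$ on $A_0\times A_0$ (linear in the first variable) is positive if $\varphi(x,x)\ge0$, invariant if $\varphi(xy,z)=\varphi(y,x^*z)$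 for all $x,y,z\in A_0$, and $\tau$-continuous if it is jointly continuous for $\tau$. -/

import Mathlib

open Filter Topology UniformSpace

universe u v

noncomputable section

/-! ### A C*-normed algebra with a second, locally convex topology -/

/-- A type synonym of `A₀` that carries the topology `τ` defined by the family of seminorms `p`
(`A₀` itself carries the topology of its C*-norm). -/
def WithTau {A₀ : Type u} [NormedRing A₀] [NormedAlgebra ℂ A₀] {Λ : Type v}
    (_p : SeminormFamily ℂ A₀ Λ) : Type u := A₀

namespace WithTau

variable {A₀ : Type u} [NormedRing A₀] [NormedAlgebra ℂ A₀] {Λ : Type v}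
  (p : SeminormFamily ℂ A₀ Λ)

instance : AddCommGroup (WithTau p) := inferInstanceAs (AddCommGroup A₀)

instance : Module ℂ (WithTau p) := inferInstanceAs (Module ℂ A₀)

/-- The identity map `A₀[‖·‖₀] → A₀[τ]`. -/
def of : A₀ ≃ₗ[ℂ] WithTau p := LinearEquiv.refl ℂ A₀

/-- The seminorms defining `τ`, seen on the synonym. -/
def seminorms : SeminormFamily ℂ (WithTau p) Λ := fun i => (p i).comp (of p).symm.toLinearMap

/-- The uniform structure of the locally convex topology `τ`: the coarsest one that is finer than
those of the seminorms `p i`. -/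
instance : UniformSpace (WithTau p) :=
  ⨅ i, (seminorms p i).toSeminormedAddCommGroup.toUniformSpace

instance : IsUniformAddGroup (WithTau p) :=
  isUniformAddGroup_iInf fun i =>
    letI := (seminorms p i).toSeminormedAddCommGroup
    inferInstance

theorem withSeminorms : WithSeminorms (seminorms p) :=
  (SeminormFamily.withSeminorms_iff_uniformSpace_eq_iInf (seminorms p)).2 rfl

instance : ContinuousSMul ℂ (WithTau p) := (withSeminorms p).continuousSMul

instance : UniformContinuousConstSMul ℂ (WithTau p) :=
  uniformContinuousConstSMul_of_continuousConstSMul ℂ (WithTau p)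

end WithTau

section Completions

variable {A₀ : Type u} [NormedRing A₀] [NormedAlgebra ℂ A₀] {Λ : Type v}

/-- The completion of `A₀[τ]`. -/
abbrev TauCompletion (p : SeminormFamily ℂ A₀ Λ) : Type u := Completion (WithTau p)

/-- The canonical map of `A₀` into the completion of `A₀[τ]`. -/
def TauCompletion.ofBase (p : SeminormFamily ℂ A₀ Λ) (x : A₀) : TauCompletion p :=
  ((WithTau.of p x : WithTau p) : Completion (WithTau p))

/-- The canonical map of the completion of `A₀[‖·‖₀]` into the completion of `A₀[τ]`, that is, the
continuous extension of the identity map of `A₀` (when `τ` is coarser than the norm topology). -/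
def TauCompletion.ofNormCompletion (p : SeminormFamily ℂ A₀ Λ) :
    Completion A₀ → TauCompletion p :=
  Completion.map (WithTau.of p)

/-- Left multiplication by `x ∈ A₀` on the completion of `A₀[τ]`: the continuous extension of
`y ↦ x y`. -/
def TauCompletion.baseMul (p : SeminormFamily ℂ A₀ Λ) (x : A₀) : TauCompletion p → TauCompletion p :=
  Completion.map fun y : WithTau p => WithTau.of p (x * (WithTau.of p).symm y)

/-- Right multiplication by `x ∈ A₀` on the completion of `A₀[τ]`: the continuous extension of
`y ↦ y x`. -/
def TauCompletion.mulBase (p : SeminormFamily ℂ A₀ Λ) (x : A₀) : TauCompletion p → TauCompletion p :=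
  Completion.map fun y : WithTau p => WithTau.of p ((WithTau.of p).symm y * x)

variable [StarRing A₀]

/-- The involution of the completion of `A₀[τ]`. -/
def TauCompletion.invol (p : SeminormFamily ℂ A₀ Λ) : TauCompletion p → TauCompletion p :=
  Completion.map fun y : WithTau p => WithTau.of p (star ((WithTau.of p).symm y))

variable (A₀) in
/-- The involution of the completion of `A₀[‖·‖₀]`. -/
def normInvol : Completion A₀ → Completion A₀ := Completion.map (star : A₀ → A₀)

variable (A₀) in
/-- The set `(A₀)₊` of the hermitian elements whose spectrum in `A₀` lies in `[0, ∞)`. -/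
def basePos : Set A₀ :=
  {x | star x = x ∧ ∀ z ∈ spectrum ℂ x, 0 ≤ z.re ∧ z.im = 0}

variable (A₀) in
/-- The positive elements of the C*-algebra that is the completion of `A₀[‖·‖₀]`. -/
def normCompletionPos : Set (Completion A₀) :=
  {b | normInvol A₀ b = b ∧ ∀ z ∈ spectrum ℂ b, 0 ≤ z.re ∧ z.im = 0}

/-- The quasi-positive elements of the completion of `A₀[τ]`: the `τ`-limits of nets in
`(A₀)₊`. -/
def quasiPos (p : SeminormFamily ℂ A₀ Λ) : Set (TauCompletion p) :=
  closure (TauCompletion.ofBase p '' basePos A₀)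

/-- The conditions on the locally convex topology `τ` of the C*-normed algebra `A₀[‖·‖₀]`, where
`p` is a defining family of seminorms of `τ`. -/
structure TauConditions (p : SeminormFamily ℂ A₀ Λ) : Prop where
  /-- `p` is directed. -/
  directed : Directed (· ≤ ·) p
  /-- `τ` is Hausdorff. -/
  hausdorff : T2Space (WithTau p)
  /-- the involution is `τ`-continuous. -/
  continuous_star :
    Continuous fun y : WithTau p => WithTau.of p (star ((WithTau.of p).symm y))
  /-- left multiplications are `τ`-continuous. -/
  continuous_baseMul :
    ∀ x : A₀, Continuous fun y : WithTau p => WithTau.of p (x * (WithTau.of p).symm y)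
  /-- right multiplications are `τ`-continuous. -/
  continuous_mulBase :
    ∀ x : A₀, Continuous fun y : WithTau p => WithTau.of p ((WithTau.of p).symm y * x)
  /-- `τ` is coarser than the norm topology. -/
  coarser : Continuous (WithTau.of p)
  /-- `τ` and the norm are compatible: a norm-Cauchy filter (net) that `τ`-converges to `0`
  converges to `0` in norm. -/
  compatible : ∀ F : Filter A₀, Cauchy F → Tendsto (WithTau.of p) F (𝓝 0) → F ≤ 𝓝 0
  /-- Weak regularity: a bound for products of commuting elements. -/
  mul_le : ∀ i, ∃ j, ∃ γ : ℝ, 0 < γ ∧ ∀ x y : A₀, x * y = y * x → p i (x * y) ≤ γ * ‖x‖ * p j y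
  /-- the positive part of the unit ball of the norm completion is `τ`-closed. -/
  isClosed_ball_pos :
    IsClosed (TauCompletion.ofNormCompletion p '' {b | b ∈ normCompletionPos A₀ ∧ ‖b‖ ≤ 1})
  /-- The quasi-positive elements in the norm completion are exactly its positive elements. -/
  quasiPos_inter :
    quasiPos p ∩ Set.range (TauCompletion.ofNormCompletion p) =
      TauCompletion.ofNormCompletion p '' normCompletionPos A₀

/-- A locally convex quasi C*-normed algebra `A[τ]` over the unital C*-normed algebra `A₀`: a quasi
*-subalgebra of the completion of `A₀[τ]` that contains the completion of `A₀[‖·‖₀]`, where `τ`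
satisfies the above conditions. Its topology is the one induced by the completion of `A₀[τ]`. -/
structure LCQuasiCStarNormedAlgebra (p : SeminormFamily ℂ A₀ Λ) where
  /-- The underlying linear subspace of the completion of `A₀[τ]`. -/
  carrier : Submodule ℂ (TauCompletion p)
  conditions : TauConditions p
  ofBase_mem : ∀ x : A₀, TauCompletion.ofBase p x ∈ carrier
  ofNormCompletion_mem : ∀ b : Completion A₀, TauCompletion.ofNormCompletion p b ∈ carrier
  invol_mem : ∀ a ∈ carrier, TauCompletion.invol p a ∈ carrier
  baseMul_mem : ∀ (x : A₀), ∀ a ∈ carrier, TauCompletion.baseMul p x a ∈ carrier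
  mulBase_mem : ∀ (x : A₀), ∀ a ∈ carrier, TauCompletion.mulBase p x a ∈ carrier

namespace LCQuasiCStarNormedAlgebra

variable {p : SeminormFamily ℂ A₀ Λ} (A : LCQuasiCStarNormedAlgebra p)

/-- The embedding of `A₀` into `A`. -/
def ofBase (x : A₀) : A.carrier := ⟨TauCompletion.ofBase p x, A.ofBase_mem x⟩

/-- The involution of `A`. -/
def invol (a : A.carrier) : A.carrier := ⟨TauCompletion.invol p a, A.invol_mem a a.2⟩

/-- The product `x a` for `x ∈ A₀` and `a ∈ A`. -/
def baseMul (x : A₀) (a : A.carrier) : A.carrier :=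
  ⟨TauCompletion.baseMul p x a, A.baseMul_mem x a a.2⟩

/-- The product `a x` for `a ∈ A` and `x ∈ A₀`. -/
def mulBase (a : A.carrier) (x : A₀) : A.carrier :=
  ⟨TauCompletion.mulBase p x a, A.mulBase_mem x a a.2⟩

end LCQuasiCStarNormedAlgebra

/-! ### Positive invariant sesquilinear forms -/

/-- The `τ`-continuous positive invariant sesquilinear forms on `A₀ × A₀`, linear in the first
and conjugate-linear in the second variable. -/
structure InvariantForm (p : SeminormFamily ℂ A₀ Λ) where
  /-- The form itself. -/
  form : A₀ →ₗ[ℂ] A₀ →ₗ⋆[ℂ] ℂ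
  nonneg : ∀ x, 0 ≤ (form x x).re ∧ (form x x).im = 0
  invariant : ∀ x y z, form (x * y) z = form y (star x * z)
  continuous : Continuous fun q : WithTau p × WithTau p =>
    form ((WithTau.of p).symm q.1) ((WithTau.of p).symm q.2)

/-- The extension of a form on `A₀ × A₀` by `τ`-continuity to the completion of `A₀[τ]`. -/
def InvariantForm.ext {p : SeminormFamily ℂ A₀ Λ} (φ : InvariantForm p) :
    TauCompletion p × TauCompletion p → ℂ :=
  ((Completion.isDenseInducing_coe (α := WithTau p)).prodMap
    (Completion.isDenseInducing_coe (α := WithTau p))).extend fun q : WithTau p × WithTau p =>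
      φ.form ((WithTau.of p).symm q.1) ((WithTau.of p).symm q.2)

/-- The set of all `τ`-continuous positive invariant sesquilinear forms on `A₀ × A₀` is
sufficient for `A`. -/
def LCQuasiCStarNormedAlgebra.FormsSufficient {p : SeminormFamily ℂ A₀ Λ}
    (A : LCQuasiCStarNormedAlgebra p) : Prop :=
  ∀ a : A.carrier, (∀ φ : InvariantForm p, φ.ext ((a : TauCompletion p), (a : TauCompletion p)) = 0) →
    a = 0

end Completions

/-! ### Operators on a dense subspace of a Hilbert space -/

section Operators

variable {H : Type u} [NormedAddCommGroup H] [InnerProductSpace ℂ H] [CompleteSpace H]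
  (D : Submodule ℂ H)

/-- The Hilbert space adjoint `X*` of an operator `X` with domain `D`. -/
def hilbertAdjoint {D : Submodule ℂ H} (X : D →ₗ[ℂ] H) : H →ₗ.[ℂ] H :=
  LinearPMap.adjoint (⟨D, X⟩ : H →ₗ.[ℂ] H)

/-- `L†(D, H)`: the operators `X` with domain `D` such that `D` is contained in the domain of
`X*` (they are closable, since `X*` is then densely defined). -/
def LDagger : Submodule ℂ (D →ₗ[ℂ] H) where
  carrier := {X | D ≤ (hilbertAdjoint X).domain}
  zero_mem' := by
    intro y _
    refine LinearPMap.mem_adjoint_domain_of_exists _ ⟨0, fun x => ?_⟩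
    change inner ℂ (0 : H) x = inner ℂ y (0 : H)
    simp
  add_mem' := by
    intro X Y hX hY y hy
    have h1 := (LinearPMap.mem_adjoint_domain_iff _ _).1 (hX hy)
    have h2 := (LinearPMap.mem_adjoint_domain_iff _ _).1 (hY hy)
    refine (LinearPMap.mem_adjoint_domain_iff _ _).2 ((h1.add h2).congr fun x => ?_)
    exact (inner_add_right y (X x) (Y x)).symm
  smul_mem' := by
    intro c X hX y hy
    have h1 := (LinearPMap.mem_adjoint_domain_iff _ _).1 (hX hy)
    refine (LinearPMap.mem_adjoint_domain_iff _ _).2 ((h1.const_smul c).congr fun x => ?_)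
    exact (inner_smul_right y (X x) c).symm

variable {D}

/-- The involution `X ↦ X† = X*|D` of `L†(D, H)`. -/
def dagger (X : LDagger D) : D →ₗ[ℂ] H :=
  (hilbertAdjoint (X : D →ₗ[ℂ] H)).toFun ∘ₗ Submodule.inclusion X.2

theorem inner_dagger (hD : Dense (D : Set H)) (X : LDagger D) (ξ η : D) :
    inner ℂ (dagger X ξ) (η : H) = inner ℂ (ξ : H) ((X : D →ₗ[ℂ] H) η) :=
  LinearPMap.adjoint_isFormalAdjoint (T := (⟨D, X⟩ : H →ₗ.[ℂ] H)) hD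
    (Submodule.inclusion X.2 ξ) η

theorem dagger_of_not_dense (hD : ¬ Dense (D : Set H)) (X : LDagger D) (ξ : D) :
    dagger X ξ = 0 :=
  LinearPMap.adjoint_apply_of_not_dense (T := (⟨D, X⟩ : H →ₗ.[ℂ] H)) hD
    (Submodule.inclusion X.2 ξ)

theorem dagger_add (X Y : LDagger D) (ξ : D) : dagger (X + Y) ξ = dagger X ξ + dagger Y ξ := by
  by_cases hD : Dense (D : Set H)
  · refine hD.eq_of_inner_left ℂ fun η hη => ?_
    have h := fun Z : LDagger D => inner_dagger hD Z ξ ⟨η, hη⟩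
    simp only at h
    rw [inner_add_left, h, h, h, ← inner_add_right]
    rfl
  · simp [dagger_of_not_dense hD]

theorem dagger_smul (c : ℂ) (X : LDagger D) (ξ : D) :
    dagger (c • X) ξ = (starRingEnd ℂ) c • dagger X ξ := by
  by_cases hD : Dense (D : Set H)
  · refine hD.eq_of_inner_left ℂ fun η hη => ?_
    have h := fun Z : LDagger D => inner_dagger hD Z ξ ⟨η, hη⟩
    simp only at h
    rw [inner_smul_left, h, h, starRingEnd_self_apply, ← inner_smul_right]
    rfl
  · simp [dagger_of_not_dense hD]

/-- The seminorm `X ↦ ‖X ξ‖ + ‖X† ξ‖` on `L†(D, H)`. -/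
def strongStarSeminorm (ξ : D) : Seminorm ℂ (LDagger D) :=
  Seminorm.of (fun X => ‖(X : D →ₗ[ℂ] H) ξ‖ + ‖dagger X ξ‖)
    (fun X Y => by
      have h1 := norm_add_le ((X : D →ₗ[ℂ] H) ξ) ((Y : D →ₗ[ℂ] H) ξ)
      have h2 := norm_add_le (dagger X ξ) (dagger Y ξ)
      rw [dagger_add]
      change ‖(X : D →ₗ[ℂ] H) ξ + (Y : D →ₗ[ℂ] H) ξ‖ + _ ≤ _
      linarith)
    (fun c X => by
      rw [dagger_smul]
      change ‖c • (X : D →ₗ[ℂ] H) ξ‖ + _ = _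
      rw [norm_smul, norm_smul, RCLike.norm_conj]
      ring)

variable (D) in
/-- The strong*-topology `τ_{s*}` of `L†(D, H)`, defined by the seminorms
`X ↦ sup_{ξ ∈ M} (‖X ξ‖ + ‖X† ξ‖)`, `M` a finite subset of `D`; equivalently, by those with `M` a
singleton. -/
@[reducible] def strongStarTopology : TopologicalSpace (LDagger D) :=
  ⨅ ξ : D, (strongStarSeminorm ξ).toSeminormedAddCommGroup.toUniformSpace.toTopologicalSpace

/-- `X □ Y` is defined and equal to `Z`, where `X □ Y = (X†)* Y` is the weak partial product of
`L†(D, H)`, defined when `Y D ⊆ D((X†)*)` and `X* D ⊆ D(Y*)`. -/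
def IsWeakProduct (X Y Z : LDagger D) : Prop :=
  (∀ ξ : D, ∃ h : (Y : D →ₗ[ℂ] H) ξ ∈ (hilbertAdjoint (dagger X)).domain,
    hilbertAdjoint (dagger X) ⟨(Y : D →ₗ[ℂ] H) ξ, h⟩ = (Z : D →ₗ[ℂ] H) ξ) ∧
  ∀ ξ : D, dagger X ξ ∈ (hilbertAdjoint (Y : D →ₗ[ℂ] H)).domain

variable {A₀ : Type u} [NormedRing A₀] [NormedAlgebra ℂ A₀] [StarRing A₀] {Λ : Type v}
  {p : SeminormFamily ℂ A₀ Λ}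

/-- The linear map `π : A → L†(D, H)` is a *-representation of `A` (with `D` dense in `H`). -/
structure IsStarRepresentation (A : LCQuasiCStarNormedAlgebra p)
    (π : A.carrier →ₗ[ℂ] LDagger D) : Prop where
  dense : Dense (D : Set H)
  /-- `π` is a *-representation of the *-algebra `A₀` on `D`: the operators `π x`, `x ∈ A₀`, map `D`
  into itself and compose as the elements of `A₀` multiply (the adjoints are covered by
  `map_invol`). -/
  base_mem : ∀ (x : A₀) (ξ : D), (π (A.ofBase x) : D →ₗ[ℂ] H) ξ ∈ D
  base_mul : ∀ (x y : A₀) (ξ : D), (π (A.ofBase (x * y)) : D →ₗ[ℂ] H) ξ =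
    (π (A.ofBase x) : D →ₗ[ℂ] H) ⟨(π (A.ofBase y) : D →ₗ[ℂ] H) ξ, base_mem y ξ⟩
  map_invol : ∀ a : A.carrier, dagger (π a) = π (A.invol a)
  map_mulBase : ∀ (a : A.carrier) (x : A₀),
    IsWeakProduct (π a) (π (A.ofBase x)) (π (A.mulBase a x))
  map_baseMul : ∀ (x : A₀) (a : A.carrier),
    IsWeakProduct (π (A.ofBase x)) (π a) (π (A.baseMul x a))

end Operators

end

/-! A continuous representation yields vector forms `φ(x, y) = ⟪π(y) ξ, π(x) ξ⟫`. Each is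
`τ`-continuous because `π` is, and its extension at `(a, a)` is `‖π(a) ξ‖²` (`ext_eq_inner`); if all
of these vanish, then `π(a) = 0` and `a = 0`.

Conversely, the direct sum of the GNS constructions of all forms works. On finitely supported
families `f` of elements of `A₀`, with inner product the sum of the forms, `A₀` acts by left
multiplication. These operators need not be bounded, but for fixed `f` the orbit map `x ↦ x f` is
`τ`-continuous (`continuous_act`), so it extends to the completion of `A₀[τ]` and defines `a f` for
every `a`. The adjoint relation `⟪f, a g⟫ = ⟪a* f, g⟫` passes from `A₀` to the completion by
density; it makes `a f` depend only on the vector that `f` represents (`orbit_congr`) and gives the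
weak products. The vector `1` in the summand of `φ` satisfies `‖a 1‖² = φ̃(a, a)`, so sufficiency of
the forms is faithfulness. -/

noncomputable section

/-! ### Extension by continuity from `A₀` to the completion of `A₀[τ]`. -/

section TauCompletion

variable {A₀ : Type u} [NormedRing A₀] [NormedAlgebra ℂ A₀] {Λ : Type v}
  (p : SeminormFamily ℂ A₀ Λ)

namespace TauCompletion

/-- The canonical map of `A₀[τ]` into its completion, as a continuous linear map. -/
def coeL : WithTau p →L[ℂ] TauCompletion p where
  toFun x := (x : Completion (WithTau p))
  map_add' := Completion.coe_add
  map_smul' c x := Completion.coe_smul c x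
  cont := Completion.continuous_coe _

variable {p}

/-- Density of `A₀`: the identities for the orbit maps below are checked on `A₀` and carried over by
this. -/
theorem eq_of_continuous {X : Type*} [TopologicalSpace X] [T2Space X] {f g : TauCompletion p → X}
    (hf : Continuous f) (hg : Continuous g) (h : ∀ x : A₀, f (ofBase p x) = g (ofBase p x))
    (a : TauCompletion p) : f a = g a :=
  Completion.induction_on a (isClosed_eq hf hg) fun x => h ((WithTau.of p).symm x)

variable [StarRing A₀]

theorem baseMul_ofBase (h : TauConditions p) (x y : A₀) :
    baseMul p x (ofBase p y) = ofBase p (x * y) := by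
  let f : WithTau p →+ WithTau p :=
    { toFun := fun y => WithTau.of p (x * (WithTau.of p).symm y)
      map_zero' := by simp
      map_add' := by simp [mul_add] }
  exact Completion.map_coe (uniformContinuous_addMonoidHom_of_continuous (f := f)
    (h.continuous_baseMul x)) _

theorem mulBase_ofBase (h : TauConditions p) (x y : A₀) :
    mulBase p x (ofBase p y) = ofBase p (y * x) := by
  let f : WithTau p →+ WithTau p :=
    { toFun := fun y => WithTau.of p ((WithTau.of p).symm y * x)
      map_zero' := by simp
      map_add' := by simp [add_mul] }
  exact Completion.map_coe (uniformContinuous_addMonoidHom_of_continuous (f := f)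
    (h.continuous_mulBase x)) _

theorem invol_ofBase (h : TauConditions p) (y : A₀) :
    invol p (ofBase p y) = ofBase p (star y) := by
  let f : WithTau p →+ WithTau p :=
    { toFun := fun y => WithTau.of p (star ((WithTau.of p).symm y))
      map_zero' := by simp
      map_add' := by simp }
  exact Completion.map_coe (uniformContinuous_addMonoidHom_of_continuous (f := f)
    h.continuous_star) _

end TauCompletion

namespace LCQuasiCStarNormedAlgebra

variable {p} [StarRing A₀] (A : LCQuasiCStarNormedAlgebra p)

/-- The embedding of `A₀` into `A` as a linear map. -/
def ofBaseL : A₀ →ₗ[ℂ] A.carrier where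
  toFun := A.ofBase
  map_add' x y := Subtype.ext ((TauCompletion.coeL p).map_add (WithTau.of p x) (WithTau.of p y))
  map_smul' c x := Subtype.ext ((TauCompletion.coeL p).map_smul c (WithTau.of p x))

theorem continuous_ofBase : Continuous fun x : WithTau p => A.ofBase ((WithTau.of p).symm x) :=
  Continuous.subtype_mk (TauCompletion.coeL p).continuous _

/-- The `comap` filter is the one along which extensions by continuity are computed at `a`. -/
theorem tendsto_ofBase (a : A.carrier) :
    Tendsto (fun x : WithTau p => A.ofBase ((WithTau.of p).symm x))
      (comap (fun x : WithTau p => (x : TauCompletion p)) (𝓝 (a : TauCompletion p))) (𝓝 a) := by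
  rw [nhds_subtype_eq_comap, tendsto_comap_iff]
  exact tendsto_comap

end LCQuasiCStarNormedAlgebra

/-! ### Invariant forms and their extensions. -/

namespace InvariantForm

variable {p} [StarRing A₀]

/-- If `φ(x, y) = ⟪ψ y, ψ x⟫` and `ψ` has the limit `v` at `a`, then the extension of `φ` takes the
value `⟪v, v⟫` at `(a, a)`. -/
theorem ext_eq_inner {H : Type*} [NormedAddCommGroup H] [InnerProductSpace ℂ H]
    (φ : InvariantForm p) (ψ : A₀ → H) (hψ : ∀ x y, φ.form x y = inner ℂ (ψ y) (ψ x))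
    (a : TauCompletion p) (v : H)
    (hv : Tendsto (fun x : WithTau p => ψ ((WithTau.of p).symm x))
      (comap (fun x : WithTau p => (x : TauCompletion p)) (𝓝 a)) (𝓝 v)) :
    φ.ext (a, a) = inner ℂ v v := by
  refine IsDenseInducing.extend_eq_of_tendsto _ ?_
  have h1 : Tendsto (fun q : WithTau p × WithTau p => q.1)
      (comap (Prod.map (fun x : WithTau p => (x : TauCompletion p))
        (fun x : WithTau p => (x : TauCompletion p))) (𝓝 (a, a)))
      (comap (fun x : WithTau p => (x : TauCompletion p)) (𝓝 a)) :=
    tendsto_comap_iff.2 ((continuous_fst.tendsto (a, a)).comp tendsto_comap)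
  have h2 : Tendsto (fun q : WithTau p × WithTau p => q.2)
      (comap (Prod.map (fun x : WithTau p => (x : TauCompletion p))
        (fun x : WithTau p => (x : TauCompletion p))) (𝓝 (a, a)))
      (comap (fun x : WithTau p => (x : TauCompletion p)) (𝓝 a)) :=
    tendsto_comap_iff.2 ((continuous_snd.tendsto (a, a)).comp tendsto_comap)
  simp_rw [hψ]
  exact (hv.comp h2).inner (hv.comp h1)

/-- Polarization: `φ` is real on the diagonal at `x + y` and at `x + i y`, which fixes the imaginary
and the real part respectively. -/
theorem conj_form (φ : InvariantForm p) (x y : A₀) :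
    (starRingEnd ℂ) (φ.form x y) = φ.form y x := by
  have h1 := (φ.nonneg (x + y)).2
  have h2 := (φ.nonneg (x + Complex.I • y)).2
  have hx := (φ.nonneg x).2
  have hy := (φ.nonneg y).2
  simp only [map_add, LinearMap.add_apply, map_smul, LinearMap.map_smulₛₗ, LinearMap.smul_apply,
    smul_eq_mul, Complex.conj_I, Complex.add_im, Complex.mul_im, Complex.mul_re, Complex.I_re,
    Complex.I_im, Complex.neg_re, Complex.neg_im, Complex.add_re, hx, hy] at h1 h2
  apply Complex.ext
  · rw [Complex.conj_re]
    linarith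
  · rw [Complex.conj_im]
    linarith

end InvariantForm

end TauCompletion

/-! ### From a representation to vector forms. -/

section Operators

variable {H : Type u} [NormedAddCommGroup H] [InnerProductSpace ℂ H] [CompleteSpace H]
  {D : Submodule ℂ H}

theorem continuous_strongStarTopology_iff {X : Type*} [TopologicalSpace X] (f : X → LDagger D) :
    Continuous[_, strongStarTopology D] f ↔ ∀ (ξ : D) (a : X),
      Tendsto (fun x => ‖(f x : D →ₗ[ℂ] H) ξ - (f a : D →ₗ[ℂ] H) ξ‖ +
        ‖dagger (f x - f a) ξ‖) (𝓝 a) (𝓝 0) := by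
  rw [continuous_iInf_rng]
  refine forall_congr' fun ξ => ?_
  let _ := (strongStarSeminorm ξ).toSeminormedAddCommGroup
  rw [continuous_iff_continuousAt]
  exact forall_congr' fun a => tendsto_iff_norm_sub_tendsto_zero

/-- A vector `w` representing `ξ ↦ ⟪y, T ξ⟫` puts `y` in the domain of the adjoint; density of `D`
makes `w` the only such vector. -/
theorem hilbertAdjoint_eq (hD : Dense (D : Set H)) (T : D →ₗ[ℂ] H) (y w : H)
    (h : ∀ ξ : D, inner ℂ w (ξ : H) = inner ℂ y (T ξ)) :
    ∃ hy : y ∈ (hilbertAdjoint T).domain, hilbertAdjoint T ⟨y, hy⟩ = w :=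
  ⟨LinearPMap.mem_adjoint_domain_of_exists (T := (⟨D, T⟩ : H →ₗ.[ℂ] H)) y ⟨w, h⟩,
    LinearPMap.adjoint_apply_eq (T := (⟨D, T⟩ : H →ₗ.[ℂ] H)) hD _ h⟩

variable {A₀ : Type u} [NormedRing A₀] [NormedAlgebra ℂ A₀] [StarRing A₀] {Λ : Type v}
  {p : SeminormFamily ℂ A₀ Λ} {A : LCQuasiCStarNormedAlgebra p}

theorem continuous_apply_of_strongStar {X : Type*} [TopologicalSpace X] {f : X → LDagger D}
    (hf : Continuous[_, strongStarTopology D] f) (ξ : D) :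
    Continuous fun x => (f x : D →ₗ[ℂ] H) ξ := by
  refine continuous_iff_continuousAt.2 fun a => tendsto_iff_norm_sub_tendsto_zero.2 ?_
  exact squeeze_zero (fun _ => norm_nonneg _) (fun _ => le_add_of_nonneg_right (norm_nonneg _))
    ((continuous_strongStarTopology_iff f).1 hf ξ a)

/-- The vector form `(x, y) ↦ ⟪π(y) ξ, π(x) ξ⟫` of a continuous *-representation. -/
def IsStarRepresentation.vectorForm {π : A.carrier →ₗ[ℂ] LDagger D}
    (h : IsStarRepresentation A π) (hπ : Continuous[_, strongStarTopology D] π) (ξ : D) :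
    InvariantForm p where
  form := LinearMap.mk₂'ₛₗ (RingHom.id ℂ) (starRingEnd ℂ)
    (fun x y => inner ℂ ((π (A.ofBaseL y) : D →ₗ[ℂ] H) ξ) ((π (A.ofBaseL x) : D →ₗ[ℂ] H) ξ))
    (fun x x' y => by simp)
    (fun c x y => by simp)
    (fun x y y' => by simp)
    (fun c x y => by simp [mul_comm])
  nonneg x := ⟨inner_self_nonneg (𝕜 := ℂ), inner_self_im (𝕜 := ℂ) _⟩
  invariant x y z := by
    change inner ℂ ((π (A.ofBase z) : D →ₗ[ℂ] H) ξ) ((π (A.ofBase (x * y)) : D →ₗ[ℂ] H) ξ) =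
      inner ℂ ((π (A.ofBase (star x * z)) : D →ₗ[ℂ] H) ξ) ((π (A.ofBase y) : D →ₗ[ℂ] H) ξ)
    have hs : A.ofBase (star x) = A.invol (A.ofBase x) :=
      Subtype.ext (TauCompletion.invol_ofBase A.conditions x).symm
    -- Multiplicativity splits off `π(x)` and `π(x*) = π(x)†`, and the adjoint relation on `D` moves
    -- one to the other side.
    rw [h.base_mul x y, h.base_mul (star x) z, hs, ← h.map_invol]
    exact (inner_dagger h.dense (π (A.ofBase x)) ⟨_, h.base_mem z ξ⟩ ⟨_, h.base_mem y ξ⟩).symm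
  continuous := by
    have h1 := (continuous_apply_of_strongStar hπ ξ).comp A.continuous_ofBase
    exact (h1.comp continuous_snd).inner (h1.comp continuous_fst)

theorem formsSufficient_of_injective {π : A.carrier →ₗ[ℂ] LDagger D}
    (h : IsStarRepresentation A π) (hinj : Function.Injective π)
    (hπ : Continuous[_, strongStarTopology D] π) : A.FormsSufficient := by
  intro a ha
  refine hinj ?_
  rw [map_zero]
  refine Subtype.ext (LinearMap.ext fun ξ => ?_)
  have h1 := (h.vectorForm hπ ξ).ext_eq_inner (fun x => (π (A.ofBase x) : D →ₗ[ℂ] H) ξ)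
    (fun _ _ => rfl) a ((π a : D →ₗ[ℂ] H) ξ)
    (((continuous_apply_of_strongStar hπ ξ).tendsto a).comp (A.tendsto_ofBase a))
  rw [ha] at h1
  exact inner_self_eq_zero.1 h1.symm

end Operators

/-! ### The direct sum of the GNS pre-Hilbert spaces. -/

section GNS

variable {A₀ : Type u} [NormedRing A₀] [NormedAlgebra ℂ A₀] [StarRing A₀] {Λ : Type v}

/-- The algebraic direct sum of copies of `A₀`, indexed by the `τ`-continuous positive invariant
sesquilinear forms. -/
abbrev FormSum (p : SeminormFamily ℂ A₀ Λ) : Type u := InvariantForm p →₀ A₀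

namespace FormSum

variable {p : SeminormFamily ℂ A₀ Λ}

/-- The element of the summand of `φ` given by `x`. -/
def single (φ : InvariantForm p) (x : A₀) : FormSum p := Finsupp.single φ x

/-- The orthogonal sum of the positive invariant forms. -/
def innerFun (f g : FormSum p) : ℂ := f.sum fun φ x => φ.form (g φ) x

/-- Allows a common index set for two vectors. The forms are evaluated at `(g φ, f φ)` because they
are linear in the first variable and `inner` in the second. -/
theorem innerFun_of_subset (f g : FormSum p) (s : Finset (InvariantForm p))
    (hs : f.support ⊆ s) : innerFun f g = ∑ φ ∈ s, φ.form (g φ) (f φ) :=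
  Finsupp.sum_of_support_subset f hs _ fun φ _ => by simp

variable (p) in
/-- The semi-inner product of the orthogonal sum of the positive invariant forms. -/
@[reducible] def core : PreInnerProductSpace.Core ℂ (FormSum p) where
  inner := innerFun
  conj_inner_symm f g := by
    classical
    rw [innerFun_of_subset g f _ (Finset.subset_union_right (s₁ := f.support)),
      innerFun_of_subset f g _ (Finset.subset_union_left (s₂ := g.support)), map_sum]
    exact Finset.sum_congr rfl fun φ _ => φ.conj_form _ _
  re_inner_nonneg f := by
    rw [innerFun_of_subset f f _ subset_rfl, map_sum]
    exact Finset.sum_nonneg fun φ _ => (φ.nonneg _).1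
  add_left f g k := by
    classical
    exact Finsupp.sum_add_index' (f := f) (g := g) (fun φ => by simp) fun φ x y => by simp
  smul_left f g c := by
    rw [innerFun_of_subset (c • f) g _ Finsupp.support_smul,
      innerFun_of_subset f g _ subset_rfl, Finset.mul_sum]
    exact Finset.sum_congr rfl fun φ _ => by simp

/-- Only a seminorm: null vectors are not divided out here, the Hausdorff completion identifies them
with `0`. -/
instance : SeminormedAddCommGroup (FormSum p) :=
  InnerProductSpace.Core.toSeminormedAddCommGroup (𝕜 := ℂ) (c := core p)

instance : InnerProductSpace ℂ (FormSum p) := InnerProductSpace.ofCore (core p)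

theorem inner_of_subset (f g : FormSum p) (s : Finset (InvariantForm p))
    (hs : f.support ⊆ s) :
    inner ℂ f g = ∑ φ ∈ s, φ.form (g φ) (f φ) :=
  innerFun_of_subset f g s hs

theorem inner_single (φ : InvariantForm p) (x y : A₀) :
    inner ℂ (single φ x) (single φ y) = φ.form y x := by
  rw [single, single, inner_of_subset _ _ {φ} Finsupp.support_single_subset]
  simp

variable (p) in
/-- The componentwise left multiplication of the direct sum by elements of `A₀`. -/
def act : A₀ →ₗ[ℂ] FormSum p →ₗ[ℂ] FormSum p :=
  LinearMap.mk₂ ℂ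
    (fun x f => Finsupp.mapRange (x * ·) (mul_zero x) f)
    (fun x y _ => Finsupp.ext fun _ => add_mul x y _)
    (fun c x _ => Finsupp.ext fun _ => smul_mul_assoc c x _)
    (fun x _ _ => Finsupp.ext fun _ => mul_add x _ _)
    (fun c x _ => Finsupp.ext fun _ => mul_smul_comm c x _)

theorem act_mul (x y : A₀) (f : FormSum p) : act p (x * y) f = act p x (act p y f) :=
  Finsupp.ext fun _ => mul_assoc x y _

theorem act_single (x : A₀) (φ : InvariantForm p) (y : A₀) :
    act p x (single φ y) = single φ (x * y) :=
  Finsupp.mapRange_single (hf := mul_zero x)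

theorem inner_act_left (x : A₀) (f g : FormSum p) :
    inner ℂ (act p x f) g = ∑ φ ∈ f.support, φ.form (g φ) (x * f φ) :=
  inner_of_subset (Finsupp.mapRange _ (mul_zero x) f) g _ Finsupp.support_mapRange

theorem inner_act (x : A₀) (f g : FormSum p) :
    inner ℂ f (act p x g) = inner ℂ (act p (star x) f) g := by
  rw [inner_act_left]
  refine (inner_of_subset f (act p x g) _ subset_rfl).trans ?_
  exact Finset.sum_congr rfl fun φ _ => φ.invariant x _ _

/-- `‖x f‖²` is a finite sum of terms `φ(x f_φ, x f_φ)`, continuous by joint continuity of `φ` and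
`τ`-continuity of right multiplications. -/
theorem continuous_act (h : TauConditions p) (f : FormSum p) :
    Continuous fun x : WithTau p => act p ((WithTau.of p).symm x) f := by
  let T : WithTau p →ₗ[ℂ] FormSum p := ((act p).flip f).comp (WithTau.of p).symm.toLinearMap
  have hsq : Continuous fun x => ‖T x‖ ^ 2 := by
    have h1 : ∀ x, ‖T x‖ ^ 2 = (∑ φ ∈ f.support,
        φ.form ((WithTau.of p).symm x * f φ) ((WithTau.of p).symm x * f φ)).re := fun x =>
      (norm_sq_eq_re_inner (𝕜 := ℂ) (T x)).trans
        (congrArg Complex.re (inner_act_left ((WithTau.of p).symm x) f (T x)))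
    simp_rw [h1]
    refine Complex.continuous_re.comp (continuous_finsetSum _ fun φ _ => ?_)
    exact φ.continuous.comp ((h.continuous_mulBase (f φ)).prodMk (h.continuous_mulBase (f φ)))
  have hnorm : Continuous fun x => ‖T x‖ := by
    simpa only [Real.sqrt_sq (norm_nonneg _)] using hsq.sqrt
  -- For a linear map, continuity of the norm at `0` suffices.
  refine continuous_of_continuousAt_zero T ?_
  rw [ContinuousAt, map_zero, tendsto_zero_iff_norm_tendsto_zero]
  simpa using hnorm.tendsto 0

end FormSum

/-! ### The GNS Hilbert space and the extended orbit maps. -/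

/-- The Hilbert space of the direct sum of the GNS representations of all `τ`-continuous positive
invariant forms. -/
abbrev GNSSpace (p : SeminormFamily ℂ A₀ Λ) : Type u := Completion (FormSum p)

variable {p : SeminormFamily ℂ A₀ Λ}

variable (p) in
/-- The dense subspace that is the common domain of the operators of the direct sum of the GNS
representations. -/
def gnsDomain : Submodule ℂ (GNSSpace p) :=
  LinearMap.range (Completion.toComplₗᵢ (𝕜 := ℂ) (E := FormSum p)).toLinearMap

theorem dense_gnsDomain : Dense (gnsDomain p : Set (GNSSpace p)) := by
  have h := Completion.denseRange_coe (α := FormSum p)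
  exact h

/-- A vector of the direct sum as an element of the domain. -/
def gnsVec (f : FormSum p) : gnsDomain p := ⟨(f : GNSSpace p), f, rfl⟩

theorem gnsVec_surjective : Function.Surjective (gnsVec (p := p)) := by
  rintro ⟨_, f, rfl⟩
  exact ⟨f, rfl⟩

namespace FormSum

/-- The map `x ↦ x f` from `A₀[τ]` to the GNS space. -/
def orbitBase (h : TauConditions p) (f : FormSum p) : WithTau p →L[ℂ] GNSSpace p :=
  Completion.toComplL.comp
    ⟨((act p).flip f).comp (WithTau.of p).symm.toLinearMap, continuous_act h f⟩

/-- The map `a ↦ a f` from the completion of `A₀[τ]` to the GNS space. -/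
def orbit (h : TauConditions p) (f : FormSum p) : TauCompletion p →L[ℂ] GNSSpace p :=
  (orbitBase h f).extend (TauCompletion.coeL p)

variable (h : TauConditions p)

theorem orbit_ofBase (f : FormSum p) (x : A₀) :
    orbit h f (TauCompletion.ofBase p x) = (act p x f : FormSum p) :=
  ContinuousLinearMap.extend_eq _ (e := TauCompletion.coeL p) Completion.denseRange_coe
    (Completion.isUniformInducing_coe _) (WithTau.of p x)

theorem orbit_add (f g : FormSum p) (a : TauCompletion p) :
    orbit h (f + g) a = orbit h f a + orbit h g a := by
  refine TauCompletion.eq_of_continuous (g := fun a => orbit h f a + orbit h g a)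
    (orbit h (f + g)).continuous
    ((orbit h f).continuous.add (orbit h g).continuous) (fun x => ?_) a
  rw [orbit_ofBase, orbit_ofBase, orbit_ofBase, map_add, Completion.coe_add]

theorem orbit_smul (c : ℂ) (f : FormSum p) (a : TauCompletion p) :
    orbit h (c • f) a = c • orbit h f a := by
  refine TauCompletion.eq_of_continuous (g := fun a => c • orbit h f a)
    (orbit h (c • f)).continuous
    ((orbit h f).continuous.const_smul c) (fun x => ?_) a
  rw [orbit_ofBase, orbit_ofBase, map_smul, Completion.coe_smul]

theorem orbit_act (f : FormSum p) (x : A₀) (a : TauCompletion p) :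
    orbit h (act p x f) a = orbit h f (TauCompletion.mulBase p x a) := by
  refine TauCompletion.eq_of_continuous (g := fun a => orbit h f (TauCompletion.mulBase p x a))
    (orbit h _).continuous
    ((orbit h f).continuous.comp Completion.continuous_map) (fun y => ?_) a
  rw [TauCompletion.mulBase_ofBase h, orbit_ofBase, orbit_ofBase, act_mul]

theorem inner_orbit (f g : FormSum p) (a : TauCompletion p) :
    inner ℂ (f : GNSSpace p) (orbit h g a) =
      inner ℂ (orbit h f (TauCompletion.invol p a)) (g : GNSSpace p) := by
  refine TauCompletion.eq_of_continuous
    (g := fun a => inner ℂ (orbit h f (TauCompletion.invol p a)) (g : GNSSpace p))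
    (continuous_const.inner (orbit h g).continuous)
    (((orbit h f).continuous.comp Completion.continuous_map).inner continuous_const)
    (fun y => ?_) a
  rw [TauCompletion.invol_ofBase h, orbit_ofBase, orbit_ofBase, Completion.inner_coe,
    Completion.inner_coe, inner_act]

/-- Multiplicativity in weak form: `a f` may lie outside the domain of left multiplication by `x`,
so `x` acts on `g` through its adjoint. -/
theorem inner_orbit_baseMul (f g : FormSum p) (x : A₀) (a : TauCompletion p) :
    inner ℂ (orbit h f (TauCompletion.baseMul p x a)) (g : GNSSpace p) =
      inner ℂ (orbit h f a) (act p (star x) g : FormSum p) := by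
  refine TauCompletion.eq_of_continuous
    (f := fun a => inner ℂ (orbit h f (TauCompletion.baseMul p x a)) (g : GNSSpace p))
    (((orbit h f).continuous.comp Completion.continuous_map).inner continuous_const)
    ((orbit h f).continuous.inner continuous_const) (fun y => ?_) a
  rw [TauCompletion.baseMul_ofBase h, orbit_ofBase, orbit_ofBase, Completion.inner_coe,
    Completion.inner_coe, inner_act, star_star, act_mul]

/-- Against a vector `k` of the dense domain, `⟪k, a f⟫ = ⟪a* k, f⟫` sees only the image of `f` in
the Hilbert space. Hence the operator of `a` is well defined there. -/
theorem orbit_congr {f g : FormSum p} (hfg : gnsVec f = gnsVec g) (a : TauCompletion p) :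
    orbit h f a = orbit h g a := by
  refine dense_gnsDomain.eq_of_inner_right ℂ fun η hη => ?_
  obtain ⟨k, hk⟩ := gnsVec_surjective ⟨η, hη⟩
  obtain rfl : (k : GNSSpace p) = η := congrArg Subtype.val hk
  rw [inner_orbit, inner_orbit]
  exact congrArg _ (congrArg Subtype.val hfg)

end FormSum

/-! ### The operators of the GNS representation. -/

open FormSum

variable (h : TauConditions p)

/-- The operator of the direct sum of the GNS representations given by an element of the completion
of `A₀[τ]`. -/
def gnsOp (a : TauCompletion p) : gnsDomain p →ₗ[ℂ] GNSSpace p where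
  -- An arbitrary representative of `ξ` is chosen; `orbit_congr` makes the choice harmless.
  toFun ξ := orbit h (Function.surjInv gnsVec_surjective ξ) a
  map_add' ξ η := by
    rw [← orbit_add]
    refine orbit_congr h (Subtype.ext ?_) a
    have h1 := congrArg Subtype.val (Function.surjInv_eq gnsVec_surjective (ξ + η))
    have h2 := congrArg Subtype.val (Function.surjInv_eq gnsVec_surjective ξ)
    have h3 := congrArg Subtype.val (Function.surjInv_eq gnsVec_surjective η)
    exact h1.trans ((congrArg₂ (· + ·) h2.symm h3.symm).trans (Completion.coe_add _ _).symm)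
  map_smul' c ξ := by
    rw [RingHom.id_apply, ← orbit_smul]
    refine orbit_congr h (Subtype.ext ?_) a
    have h1 := congrArg Subtype.val (Function.surjInv_eq gnsVec_surjective (c • ξ))
    have h2 := congrArg Subtype.val (Function.surjInv_eq gnsVec_surjective ξ)
    exact h1.trans ((congrArg (c • ·) h2.symm).trans (Completion.coe_smul _ _).symm)

theorem gnsOp_gnsVec (a : TauCompletion p) (f : FormSum p) :
    gnsOp h a (gnsVec f) = orbit h f a :=
  orbit_congr h (Function.surjInv_eq gnsVec_surjective (gnsVec f)) a

theorem inner_gnsOp (a : TauCompletion p) (ξ η : gnsDomain p) :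
    inner ℂ (ξ : GNSSpace p) (gnsOp h a η) =
      inner ℂ (gnsOp h (TauCompletion.invol p a) ξ) (η : GNSSpace p) := by
  obtain ⟨f, rfl⟩ := gnsVec_surjective ξ
  obtain ⟨g, rfl⟩ := gnsVec_surjective η
  rw [gnsOp_gnsVec, gnsOp_gnsVec]
  exact inner_orbit h f g a

theorem hilbertAdjoint_gnsOp (a : TauCompletion p) (ξ : gnsDomain p) :
    ∃ hξ : (ξ : GNSSpace p) ∈ (hilbertAdjoint (gnsOp h a)).domain,
      hilbertAdjoint (gnsOp h a) ⟨ξ, hξ⟩ = gnsOp h (TauCompletion.invol p a) ξ :=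
  hilbertAdjoint_eq dense_gnsDomain _ _ _ fun η => (inner_gnsOp h a ξ η).symm

/-- Used twice: it computes `π(x) □ π(a)`, and applied to `x*` and `a*` it gives the domain
condition of `π(a) □ π(x)`. -/
theorem hilbertAdjoint_gnsOp_ofBase (x : A₀) (a : TauCompletion p) (ξ : gnsDomain p) :
    ∃ hξ : gnsOp h a ξ ∈ (hilbertAdjoint (gnsOp h (TauCompletion.ofBase p (star x)))).domain,
      hilbertAdjoint (gnsOp h (TauCompletion.ofBase p (star x))) ⟨_, hξ⟩ =
        gnsOp h (TauCompletion.baseMul p x a) ξ := by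
  refine hilbertAdjoint_eq dense_gnsDomain _ _ _ fun η => ?_
  obtain ⟨f, rfl⟩ := gnsVec_surjective ξ
  obtain ⟨g, rfl⟩ := gnsVec_surjective η
  rw [gnsOp_gnsVec, gnsOp_gnsVec, gnsOp_gnsVec, orbit_ofBase]
  exact inner_orbit_baseMul h f g x a

theorem gnsOp_ofBase (x : A₀) (f : FormSum p) :
    gnsOp h (TauCompletion.ofBase p x) (gnsVec f) = gnsVec (act p x f) := by
  rw [gnsOp_gnsVec, orbit_ofBase]
  rfl

theorem continuous_gnsOp (ξ : gnsDomain p) : Continuous fun a => gnsOp h a ξ :=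
  (orbit h _).continuous

/-! ### The GNS representation of `A`: weak products, continuity, faithfulness. -/

variable (A : LCQuasiCStarNormedAlgebra p)

/-- The direct sum of the GNS representations of all `τ`-continuous positive invariant forms. -/
def gnsRep : A.carrier →ₗ[ℂ] LDagger (gnsDomain p) where
  toFun a := ⟨gnsOp A.conditions a, fun y hy =>
    (hilbertAdjoint_gnsOp _ (a : TauCompletion p) ⟨y, hy⟩).1⟩
  map_add' _ _ := Subtype.ext (LinearMap.ext fun _ => map_add (orbit _ _) _ _)
  map_smul' _ _ := Subtype.ext (LinearMap.ext fun _ => map_smul (orbit _ _) _ _)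

theorem coe_gnsRep (a : A.carrier) :
    (gnsRep A a : gnsDomain p →ₗ[ℂ] GNSSpace p) = gnsOp A.conditions (a : TauCompletion p) := rfl

theorem gnsRep_gnsVec (a : A.carrier) (f : FormSum p) :
    (gnsRep A a : gnsDomain p →ₗ[ℂ] GNSSpace p) (gnsVec f) =
      orbit A.conditions f (a : TauCompletion p) :=
  gnsOp_gnsVec A.conditions a f

theorem gnsRep_ofBase (x : A₀) (f : FormSum p) :
    (gnsRep A (A.ofBase x) : gnsDomain p →ₗ[ℂ] GNSSpace p) (gnsVec f) = gnsVec (act p x f) :=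
  gnsOp_ofBase A.conditions x f

theorem dagger_gnsRep (a : A.carrier) :
    dagger (gnsRep A a) = gnsRep A (A.invol a) :=
  LinearMap.ext fun ξ => (hilbertAdjoint_gnsOp A.conditions (a : TauCompletion p) ξ).2

theorem gnsRep_ofBase_mem (x : A₀) (ξ : gnsDomain p) :
    (gnsRep A (A.ofBase x) : gnsDomain p →ₗ[ℂ] GNSSpace p) ξ ∈ gnsDomain p := by
  obtain ⟨f, rfl⟩ := gnsVec_surjective ξ
  rw [gnsRep_ofBase]
  exact (gnsVec (act p x f)).2

theorem gnsRep_ofBase_mul (x y : A₀) (ξ : gnsDomain p) :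
    (gnsRep A (A.ofBase (x * y)) : gnsDomain p →ₗ[ℂ] GNSSpace p) ξ =
      (gnsRep A (A.ofBase x) : gnsDomain p →ₗ[ℂ] GNSSpace p)
        ⟨(gnsRep A (A.ofBase y) : gnsDomain p →ₗ[ℂ] GNSSpace p) ξ, gnsRep_ofBase_mem A y ξ⟩ := by
  obtain ⟨f, rfl⟩ := gnsVec_surjective ξ
  simp only [gnsRep_ofBase, Subtype.coe_eta, act_mul]

theorem isWeakProduct_gnsRep_mulBase (a : A.carrier) (x : A₀) :
    IsWeakProduct (gnsRep A a) (gnsRep A (A.ofBase x)) (gnsRep A (A.mulBase a x)) := by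
  constructor
  · intro ξ
    obtain ⟨f, rfl⟩ := gnsVec_surjective ξ
    have ha : (gnsRep A (A.mulBase a x) : gnsDomain p →ₗ[ℂ] GNSSpace p) (gnsVec f) =
        gnsOp A.conditions a (gnsVec (act p x f)) := by
      rw [gnsRep_gnsVec, gnsOp_gnsVec, orbit_act]
      rfl
    rw [dagger_gnsRep, gnsRep_ofBase, ha]
    refine hilbertAdjoint_eq dense_gnsDomain _ _ _ fun η => ?_
    -- Conjugating puts the operator of `a` in the second slot, where the adjoint relation produces
    -- `a*` directly and `a** = a` is not needed.
    rw [← inner_conj_symm, inner_gnsOp, inner_conj_symm]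
    rfl
  · intro ξ
    rw [dagger_gnsRep, coe_gnsRep, coe_gnsRep]
    have h1 := (hilbertAdjoint_gnsOp_ofBase A.conditions (star x)
      (A.invol a : TauCompletion p) ξ).1
    rwa [star_star] at h1

theorem isWeakProduct_gnsRep_baseMul (x : A₀) (a : A.carrier) :
    IsWeakProduct (gnsRep A (A.ofBase x)) (gnsRep A a) (gnsRep A (A.baseMul x a)) := by
  have hx : dagger (gnsRep A (A.ofBase x)) = gnsRep A (A.ofBase (star x)) := by
    rw [dagger_gnsRep]
    exact congrArg (fun b => (gnsRep A b : gnsDomain p →ₗ[ℂ] GNSSpace p))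
      (Subtype.ext (TauCompletion.invol_ofBase A.conditions x))
  constructor
  · intro ξ
    rw [hx]
    exact hilbertAdjoint_gnsOp_ofBase A.conditions x a ξ
  · intro ξ
    rw [hx]
    obtain ⟨f, rfl⟩ := gnsVec_surjective ξ
    rw [gnsRep_ofBase]
    exact (hilbertAdjoint_gnsOp A.conditions (a : TauCompletion p) _).1

theorem isStarRepresentation_gnsRep : IsStarRepresentation A (gnsRep A) where
  dense := dense_gnsDomain
  base_mem := gnsRep_ofBase_mem A
  base_mul := gnsRep_ofBase_mul A
  map_invol := dagger_gnsRep A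
  map_mulBase := isWeakProduct_gnsRep_mulBase A
  map_baseMul := isWeakProduct_gnsRep_baseMul A

theorem continuous_gnsRep : Continuous[_, strongStarTopology (gnsDomain p)] (gnsRep A) := by
  refine (continuous_strongStarTopology_iff _).2 fun ξ a => ?_
  have h1 : Continuous fun b : A.carrier => gnsOp A.conditions (b : TauCompletion p) ξ :=
    (continuous_gnsOp _ ξ).comp continuous_subtype_val
  have h2 : Continuous fun b : A.carrier =>
      gnsOp A.conditions (TauCompletion.invol p ((b - a : A.carrier) : TauCompletion p)) ξ :=
    (continuous_gnsOp _ ξ).comp (Completion.continuous_map.comp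
      (continuous_subtype_val.comp (continuous_id.sub continuous_const)))
  have h3 : Continuous fun b : A.carrier =>
      ‖gnsOp A.conditions (b : TauCompletion p) ξ - gnsOp A.conditions (a : TauCompletion p) ξ‖ +
      ‖dagger (gnsRep A b - gnsRep A a) ξ‖ := by
    -- The adjoint part is the orbit map at `(b - a)*`, continuous in `b`.
    simp_rw [← map_sub, dagger_gnsRep]
    exact (h1.sub continuous_const).norm.add h2.norm
  have h4 := h3.tendsto a
  rw [sub_self, sub_self, norm_zero] at h4
  have h5 : dagger (0 : LDagger (gnsDomain p)) ξ = 0 := by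
    have := dagger_smul (0 : ℂ) (0 : LDagger (gnsDomain p)) ξ
    rwa [zero_smul, map_zero, zero_smul] at this
  rw [h5, norm_zero, add_zero] at h4
  exact h4

/-- Tests `π(a) = 0` on the vectors `single φ 1`, where it says `φ̃(a, a) = 0`. -/
theorem gnsRep_injective (hA : A.FormsSufficient) : Function.Injective (gnsRep A) := by
  refine (injective_iff_map_eq_zero _).2 fun a ha => hA a fun φ => ?_
  have h1 : orbit A.conditions (single φ 1) (a : TauCompletion p) = 0 := by
    rw [← gnsOp_gnsVec]
    exact LinearMap.congr_fun (congrArg Subtype.val ha) (gnsVec (single φ 1))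
  rw [φ.ext_eq_inner (fun x => ((single φ x : FormSum p) : GNSSpace p)) (fun x y => ?_) a 0,
    inner_zero_left]
  -- Since `x · 1 = x`, the vectors `single φ x` are the orbit of `single φ 1`; as `x` tends to `a`
  -- they converge to its value at `a`, which is `0`.
  · rw [← h1]
    refine (((orbit A.conditions (single φ 1)).continuous.tendsto _).comp tendsto_comap).congr
      fun x => ?_
    refine (orbit_ofBase A.conditions (single φ 1) ((WithTau.of p).symm x)).trans ?_
    rw [act_single, mul_one]
  · rw [Completion.inner_coe, inner_single]

end GNS

end

theorem theorem6p6 {A₀ : Type u} [NormedRing A₀] [NormedAlgebra ℂ A₀] [StarRing A₀]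
    [StarModule ℂ A₀] [CStarRing A₀] {Λ : Type v} (p : SeminormFamily ℂ A₀ Λ)
    (A : LCQuasiCStarNormedAlgebra p) :
    (∃ (H : Type u) (_ : NormedAddCommGroup H) (_ : InnerProductSpace ℂ H) (_ : CompleteSpace H)
      (D : Submodule ℂ H) (π : A.carrier →ₗ[ℂ] LDagger D),
        IsStarRepresentation A π ∧ Function.Injective π ∧
          Continuous[instTopologicalSpaceSubtype, strongStarTopology D] π) ↔
      A.FormsSufficient := by
  constructor
  · rintro ⟨H, _, _, _, D, π, h, hinj, hπ⟩
    exact formsSufficient_of_injective h hinj hπ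
  · intro hA
    -- The forms make up a type in the universe of `A₀`, so the sum over all of them stays in `Type
    -- u`.
    exact ⟨GNSSpace p, inferInstance, inferInstance, inferInstance, gnsDomain p, gnsRep A,
      isStarRepresentation_gnsRep A, gnsRep_injective A hA, continuous_gnsRep A⟩
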